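/- Let $R$ be an associative ring with identity, not necessarily commutative. Suppose that for every sequence $(a_i)_{i\ge 1}$ of elements of $R$ there exist an integer $k\ge 1$ and integers $n_1,\dots,n_k\ge 2$ such that $$(a_1-a_1^{n_1})(a_2-a_2^{n_2})\cdots(a_k-a_k^{n_k})=0 .$$ Then $R$ is J-clean-like, that is, for every $a\in R$ there exists $p\in R$ with $p=p^m$ for some integer $m\ge 2$ such that $a-p\in J(R)$, where $J(R)$ is the Jacobson radical of $R$. -/

import Mathlib

/-- An element `p` of a ring is potent if `p = p ^ m` for some `m ≥ 2`. -/
def IsPotentElem {R : Type*} [Ring R] (p : R) : Prop :=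
  ∃ m : ℕ, 2 ≤ m ∧ p = p ^ m

/-- A ring `R` (associative, with identity, not necessarily commutative) is J-clean-like if for
every `a` there is a potent `p` with `a - p` in the Jacobson radical of `R`. -/
def IsJCleanLike (R : Type*) [Ring R] : Prop :=
  ∀ a : R, ∃ p : R, IsPotentElem p ∧ a - p ∈ Ring.jacobson R

/-! The constant sequence 2 gives positive characteristic `q`; constant sequences `a` then make
every `a` integral over the finite ring `ZMod q`, so its powers repeat and `a` is potent plus
nilpotent. Nilpotents lie in the radical: otherwise some nilpotent `b` acts on a simple module by `v
↦ w ↦ 0` with `w ≠ 0`, simplicity gives `t` with `w ↦ v ↦ 0`, and the sequence `b, t, b, ...`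
violates the hypothesis, since powers `≥ 2` vanish on the vectors met. -/

/-- If every sequence in `R` has a vanishing product of elements `a i - a i ^ n i` with `n i ≥ 2`,
then `R` has positive characteristic. -/
theorem ringChar_ne_zero_of_forall_seq {R : Type*} [Ring R]
    (h : ∀ a : ℕ → R, ∃ k : ℕ, 1 ≤ k ∧ ∃ n : Fin k → ℕ, (∀ i, 2 ≤ n i) ∧
      (List.ofFn fun i : Fin k => a i - a i ^ n i).prod = 0) :
    ringChar R ≠ 0 := by
  obtain ⟨k, -, n, hn, hz⟩ := h fun _ => 2
  have hcast : ((∏ i, ((2 : ℤ) - 2 ^ n i) : ℤ) : R) = 0 := by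
    rw [← hz, ← List.prod_ofFn, ← eq_intCast (Int.castRingHom R), map_list_prod, List.map_ofFn]
    congr 2
    ext i
    simp
  intro h0
  rw [CharP.intCast_eq_zero_iff R (ringChar R), h0, Nat.cast_zero, zero_dvd_iff,
    Finset.prod_eq_zero_iff] at hcast
  obtain ⟨i, -, hi⟩ := hcast
  have : (2 : ℤ) ^ 1 < 2 ^ n i := pow_lt_pow_right₀ (by norm_num) (hn i)
  omega

/-- An element annihilated by a product of polynomials `X - X ^ n i` with `n i ≥ 2` is integral. -/
theorem isIntegral_of_prod_sub_pow_eq_zero {S R : Type*} [CommRing S] [Ring R] [Algebra S R]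
    {a : R} {k : ℕ} {n : Fin k → ℕ} (hn : ∀ i, 2 ≤ n i)
    (hz : (List.ofFn fun i : Fin k => a - a ^ n i).prod = 0) : IsIntegral S a := by
  nontriviality S
  refine ⟨∏ i, (Polynomial.X ^ n i - Polynomial.X), Polynomial.monic_prod_of_monic _ _ fun i _ =>
    Polynomial.monic_X_pow_sub (by rw [Polynomial.degree_X]; exact_mod_cast hn i), ?_⟩
  have key : Polynomial.aeval a (∏ i, (Polynomial.X - Polynomial.X ^ n i : Polynomial S)) = 0 := by
    rw [← hz, ← List.prod_ofFn, map_list_prod, List.map_ofFn]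
    congr 2
    ext i
    simp
  have hneg : (∏ i, (Polynomial.X ^ n i - Polynomial.X) : Polynomial S) =
      (∏ _i : Fin k, (-1)) * ∏ i, (Polynomial.X - Polynomial.X ^ n i) := by
    rw [← Finset.prod_mul_distrib]
    exact Finset.prod_congr rfl fun i _ => by ring
  rw [← Polynomial.aeval_def, hneg, map_mul, key, mul_zero]

/-- An integral element over a finite ring has only finitely many distinct powers. -/
theorem IsIntegral.exists_pow_add_eq {S R : Type*} [CommRing S] [Finite S] [Ring R] [Algebra S R]
    {a : R} (ha : IsIntegral S a) : ∃ i d : ℕ, 0 < d ∧ a ^ (i + d) = a ^ i := by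
  have : Module.Finite S (Algebra.adjoin S {a}) := .of_fg ha.fg_adjoin_singleton
  have : Finite (Algebra.adjoin S {a}) := Module.finite_of_finite S
  obtain ⟨i, j, hij, he⟩ := Finite.exists_ne_map_eq_of_infinite
    fun i : ℕ => (⟨a, Algebra.self_mem_adjoin_singleton S a⟩ : Algebra.adjoin S {a}) ^ i
  replace he : a ^ i = a ^ j := congrArg Subtype.val he
  rcases lt_or_gt_of_ne hij with hlt | hlt
  · exact ⟨i, j - i, by omega, by rw [Nat.add_sub_cancel' hlt.le, he]⟩
  · exact ⟨j, i - j, by omega, by rw [Nat.add_sub_cancel' hlt.le, he]⟩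

theorem pow_add_mul_eq_of_pow_add_eq {M : Type*} [Monoid M] {a : M} {i d : ℕ}
    (h : a ^ (i + d) = a ^ i) {j : ℕ} (hj : i ≤ j) (t : ℕ) : a ^ (j + d * t) = a ^ j := by
  induction t with
  | zero => simp
  | succ t ih =>
    obtain ⟨c, rfl⟩ := Nat.exists_eq_add_of_le hj
    rw [← ih, show i + c + d * (t + 1) = (i + d) + (c + d * t) by ring, pow_add, h, ← pow_add,
      add_assoc]

/-- An element with finitely many distinct powers is a potent element plus a nilpotent one. -/
theorem exists_isPotentElem_isNilpotent_sub {R : Type*} [Ring R] {a : R} {i d : ℕ} (hd : 0 < d)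
    (h : a ^ (i + d) = a ^ i) : ∃ p : R, IsPotentElem p ∧ IsNilpotent (a - p) := by
  have hi : i ≤ 1 + d * i := (Nat.le_mul_of_pos_left i hd).trans (Nat.le_add_left _ _)
  -- The exponent is at least `i` and congruent to 1 mod `d`; multiplying it by `d + 1` adds a
  -- multiple of the period.
  refine ⟨a ^ (1 + d * i), ⟨d + 1, by omega, ?_⟩, i + 1, ?_⟩
  · rw [← pow_mul, ← pow_add_mul_eq_of_pow_add_eq h hi (1 + d * i)]
    congr 1
    ring
  · have hc : Commute a (1 - a ^ (d * i)) :=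
      (Commute.one_right a).sub_right ((Commute.refl a).pow_right _)
    rw [show a - a ^ (1 + d * i) = a * (1 - a ^ (d * i)) by rw [mul_sub, mul_one, pow_add, pow_one],
      hc.mul_pow, pow_succ' (1 - _), ← mul_assoc, mul_sub, mul_one, ← pow_add,
      pow_add_mul_eq_of_pow_add_eq h i.le_succ, sub_self, zero_mul]

/-- If `b` sends `v` to `w ≠ 0` and kills `w` in a simple module, some element sends `w` to `v`
and kills `v`. -/
theorem IsSimpleModule.exists_smul_eq_and_smul_eq_zero {R M : Type*} [Ring R] [AddCommGroup M]
    [Module R M] [IsSimpleModule R M] {b : R} {v w : M} (hbv : b • v = w) (hbw : b • w = 0)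
    (hw : w ≠ 0) : ∃ t : R, t • w = v ∧ t • v = 0 := by
  obtain ⟨r, hr⟩ := IsSimpleModule.toSpanSingleton_surjective R hw v
  replace hr : r • w = v := hr
  -- The factor `1 - r * b` fixes `w` and kills `v`.
  refine ⟨r * (1 - r * b), ?_, ?_⟩
  · rw [mul_smul, sub_smul, mul_smul, hbw, smul_zero, sub_zero, one_smul, hr]
  · rw [mul_smul, sub_smul, mul_smul, hbv, hr, one_smul, sub_self, smul_zero]

theorem sub_pow_smul_eq {R M : Type*} [Ring R] [AddCommGroup M] [Module R M] {b : R} {v w : M}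
    (hbv : b • v = w) (hbw : b • w = 0) {n : ℕ} (hn : 2 ≤ n) : (b - b ^ n) • v = w := by
  obtain ⟨c, rfl⟩ := Nat.exists_eq_add_of_le' hn
  rw [sub_smul, pow_add, mul_smul, pow_two, mul_smul, hbv, hbw, smul_zero, sub_zero]

/-- If `b` and `t` swap `v` and `w` up to killing one of them, then products of elements
`c - c ^ n` with `n ≥ 2` along the alternating sequence of `b` and `t` do not vanish. -/
theorem prod_alternating_sub_pow_ne_zero {R M : Type*} [Ring R] [AddCommGroup M] [Module R M]
    {k : ℕ} {b t : R} {v w : M} (hbv : b • v = w) (hbw : b • w = 0) (htw : t • w = v)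
    (htv : t • v = 0) (hw : w ≠ 0) {n : Fin k → ℕ} (hn : ∀ i, 2 ≤ n i) :
    (List.ofFn fun i : Fin k => (if Even (i : ℕ) then b else t) -
      (if Even (i : ℕ) then b else t) ^ n i).prod ≠ 0 := by
  have hv : v ≠ 0 := by
    rintro rfl
    exact hw (by rw [← hbv, smul_zero])
  suffices ∃ x : M, (List.ofFn fun i : Fin k => (if Even (i : ℕ) then b else t) -
      (if Even (i : ℕ) then b else t) ^ n i).prod • x = w by
    obtain ⟨x, hx⟩ := this
    intro h0
    exact hw (by rw [← hx, h0, zero_smul])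
  induction k generalizing b t v w with
  | zero => exact ⟨w, by simp⟩
  | succ k ih =>
    -- Dropping the first factor swaps the roles of `b, v` and `t, w`.
    obtain ⟨x, hx⟩ := ih htw htv hbv hbw hv (fun i => hn i.succ) hw
    refine ⟨x, ?_⟩
    simp only [List.ofFn_succ, List.prod_cons, Fin.val_zero, Even.zero, if_true, mul_smul,
      Fin.val_succ, Nat.even_add_one, ite_not]
    rw [hx, sub_pow_smul_eq hbv hbw (hn 0)]

/-- If every sequence in `R` has a vanishing product of elements `a i - a i ^ n i` with `n i ≥ 2`,
then nilpotent elements lie in the Jacobson radical. -/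
theorem IsNilpotent.mem_jacobson_of_forall_seq {R : Type*} [Ring R]
    (h : ∀ a : ℕ → R, ∃ k : ℕ, 1 ≤ k ∧ ∃ n : Fin k → ℕ, (∀ i, 2 ≤ n i) ∧
      (List.ofFn fun i : Fin k => a i - a i ^ n i).prod = 0) {b : R} (hb : IsNilpotent b) :
    b ∈ Ring.jacobson R := by
  refine (Submodule.mem_sInf).2 fun m hm => ?_
  have : IsSimpleModule R (R ⧸ m) := isSimpleModule_iff_isCoatom.2 hm
  by_contra hbm
  have hex : ∃ c, b ^ c ∈ m := by
    obtain ⟨c, hc⟩ := hb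
    exact ⟨c, hc ▸ m.zero_mem⟩
  classical
  -- With the least exponent written `c + 2`, the classes of `b ^ c` and `b ^ (c + 1)` serve as `v`
  -- and `w`.
  obtain ⟨c, hc⟩ : ∃ c, Nat.find hex = c + 2 := by
    refine Nat.exists_eq_add_of_le' ((Nat.two_le_iff _).2 ⟨fun h0 => ?_, fun h1 => ?_⟩)
    · have := Nat.find_spec hex
      rw [h0, pow_zero] at this
      exact hbm (by simpa using m.smul_mem b this)
    · have := Nat.find_spec hex
      rw [h1, pow_one] at this
      exact hbm this
  have hmem : b ^ (c + 2) ∈ m := hc ▸ Nat.find_spec hex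
  have hnot : b ^ (c + 1) ∉ m := Nat.find_min hex (by omega)
  have hbv : b • (m.mkQ (b ^ c)) = m.mkQ (b ^ (c + 1)) := by
    rw [← map_smul, smul_eq_mul, pow_succ']
  have hbw : b • (m.mkQ (b ^ (c + 1))) = 0 := by
    rw [← map_smul, smul_eq_mul, ← pow_succ']
    simpa using hmem
  have hw : m.mkQ (b ^ (c + 1)) ≠ 0 := by simpa using hnot
  obtain ⟨t, htw, htv⟩ := IsSimpleModule.exists_smul_eq_and_smul_eq_zero hbv hbw hw
  obtain ⟨k, -, n, hn, hz⟩ := h fun i => if Even i then b else t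
  exact prod_alternating_sub_pow_ne_zero hbv hbw htw htv hw hn hz

theorem theorem4p13 (R : Type*) [Ring R]
    (h : ∀ a : ℕ → R, ∃ k : ℕ, 1 ≤ k ∧ ∃ n : Fin k → ℕ, (∀ i, 2 ≤ n i) ∧
      (List.ofFn fun i : Fin k => a i - a i ^ n i).prod = 0) :
    IsJCleanLike R := by
  intro a
  have : NeZero (ringChar R) := ⟨ringChar_ne_zero_of_forall_seq h⟩
  let _ : Algebra (ZMod (ringChar R)) R := ZMod.algebra R (ringChar R)
  obtain ⟨k, -, n, hn, hz⟩ := h fun _ => a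
  have ha : IsIntegral (ZMod (ringChar R)) a := isIntegral_of_prod_sub_pow_eq_zero hn hz
  obtain ⟨i, d, hd, hid⟩ := ha.exists_pow_add_eq
  obtain ⟨p, hp, hnil⟩ := exists_isPotentElem_isNilpotent_sub hd hid
  exact ⟨p, hp, hnil.mem_jacobson_of_forall_seq h⟩
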